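/- Let $P, Q$ be polynomials with complex coefficients, let $A \ge 0$, and let $(R_j)_{j \ge 0}$ be complex numbers such that the series $R(z^{-1}) = \sum_{j \ge 0} R_j z^{-j}$ converges for all $|z| > A$. Consider the linear differential operator $$\mathcal{P} = P\big(\tfrac{\partial}{\partial z}\big) + \frac{1}{z}\, Q\big(\tfrac{\partial}{\partial z}\big) + \frac{1}{z^2}\, R(z^{-1}).$$ (The equation $\mathcal{P}\Phi = 0$ is a level 1 differential equation when $P$ is monic of degree $d$ with simple roots and $Q$ has degree $d-1$ and does not vanish at any root of $P$; these extra conditions are not needed here.) Let $\alpha \in \mathbb{C}$ and $\theta, \Lambda \in \mathbb{R}$. Let $\Gamma = \{\alpha + r e^{i\theta} : r > 0\}$ be the ray that leaves $\alpha$ at angle $\theta$, and let $\Pi$ be the open half-plane $\mathrm{Re}(z e^{i\theta}) > \Lambda$. For an integer $\nu \ge 1$ let $$[\partial_\alpha^{-\nu}\varphi](a) = \frac{1}{\Gamma(\nu)} \int_{\alpha}^{a} (a-\zeta)^{\nu-1} \varphi(\zeta)\, d\zeta,$$ integrated along the straight path from $\alpha$ to $a$, let $R(\partial_\alpha^{-1})\varphi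 = \sum_{j \ge 0} R_j\, (\partial_\alpha^{-1})^j \varphi$, and let $$\hat{\mathcal{P}}_\alpha = P(-\zeta) + \partial_\alpha^{-1} \circ Q(-\zeta) + \partial_\alpha^{-2} \circ R(\partial_\alpha^{-1}),$$ where $P(-\zeta)$ and $Q(-\zeta)$ act by multiplication. Let $\Omega_\alpha \subset \mathbb{C}$ be an open set that contains $\Gamma$, and let $\psi_\alpha$ be a holomorphic function on $\Omega_\alpha$ whose Laplace transform along $\Gamma$, $$\Psi_\alpha(z) = \int_{\Gamma} e^{-z\zeta} \psi_\alpha(\zeta)\, d\zeta,$$ is well-defined on $\Pi$: the integral converges absolutely for every $z \in \Pi$. (This holds, for example, if $|\psi_\alpha(\zeta)| \le C |\zeta-\alpha|^{\sigma} e^{\Lambda|\zeta-\alpha|}$ on $\Omega_\alpha$ for some constants $C$ and $\sigma > -1$.) Suppose that $\psi_\alpha$ satisfies the integral equation $\hat{\mathcal{P}}_\alpha \psi_\alpha = 0$ at every point of $\Omega_\alpha$ that is joined to $\alpha$ by a straight path in $\Omega_\alpha$ (that is, on all of $\Omega_\alpha$ when $\Omega_\alpha$ is star-shaped around $\alpha$;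 the path does not include its starting point $\alpha$). Then $\Psi_\alpha$ is holomorphic on $\Pi$ and satisfies the differential equation $\mathcal{P}\Psi_\alpha = 0$ at every $z \in \Pi$ with $|z| > A$. -/

import Mathlib

namespace LevelOne

/-- The point of the ray leaving `α` at angle `θ` that lies at distance `r` from `α`. -/
noncomputable def rayPoint (α : ℂ) (θ r : ℝ) : ℂ :=
  α + (r : ℂ) * Complex.exp ((θ : ℂ) * Complex.I)

/-- The open ray that leaves `α` at angle `θ`; the base point `α` is not included. -/
def ray (α : ℂ) (θ : ℝ) : Set ℂ :=
  rayPoint α θ '' Set.Ioi 0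

/-- The half-plane `Re (z e^{iθ}) > Λ` of the frequency domain. -/
def halfPlane (θ Λ : ℝ) : Set ℂ :=
  {z | Λ < (z * Complex.exp ((θ : ℂ) * Complex.I)).re}

/-- The integral of `f dζ` along the straight path from `α` to `a`. -/
noncomputable def segIntegral (α a : ℂ) (f : ℂ → ℂ) : ℂ :=
  ∫ t in (0 : ℝ)..1, f (α + (t : ℂ) * (a - α)) * (a - α)

/-- The Riemann-Liouville integral `∂^{-ν}` with base point `α`, of integer order `ν ≥ 1`:
`(∂^{-ν} φ)(a) = 1 / Γ(ν) * ∫_α^a (a - ζ)^(ν - 1) φ(ζ) dζ`.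
Only the orders `1` and `2` are used below; order `1` is integration from `α`. -/
noncomputable def fracIntegral (α : ℂ) (ν : ℕ) (φ : ℂ → ℂ) (a : ℂ) : ℂ :=
  ((ν - 1).factorial : ℂ)⁻¹ * segIntegral α a (fun ζ => (a - ζ) ^ (ν - 1) * φ ζ)

/-- The operator `R(∂^{-1})`, where `R` is the power series with coefficients `R j`:
`∂^{-1}` is substituted for the variable, so the `j`-th term is `R j` times the `j`-th power
(iterate) of the operator `∂^{-1}`. -/
noncomputable def seriesOfIntegral (R : ℕ → ℂ) (α : ℂ) (φ : ℂ → ℂ) (a : ℂ) : ℂ :=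
  ∑' j : ℕ, R j * ((fracIntegral α 1)^[j] φ) a

/-- The integral operator `P(-ζ) + ∂^{-1} ∘ Q(-ζ) + ∂^{-2} ∘ R(∂^{-1})` on the position domain,
with base point `α`. -/
noncomputable def positionOp (P Q : Polynomial ℂ) (R : ℕ → ℂ) (α : ℂ) (φ : ℂ → ℂ) (a : ℂ) : ℂ :=
  P.eval (-a) * φ a
    + fracIntegral α 1 (fun ζ => Q.eval (-ζ) * φ ζ) a
    + fracIntegral α 2 (seriesOfIntegral R α φ) a

/-- The constant-coefficient differential operator `P(∂/∂z)`. -/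
noncomputable def polyDeriv (P : Polynomial ℂ) (Φ : ℂ → ℂ) (z : ℂ) : ℂ :=
  P.sum fun n c => c * iteratedDeriv n Φ z

/-- The differential operator `P(∂/∂z) + z^{-1} Q(∂/∂z) + z^{-2} R(z^{-1})` on the frequency
domain. -/
noncomputable def frequencyOp (P Q : Polynomial ℂ) (R : ℕ → ℂ) (Φ : ℂ → ℂ) (z : ℂ) : ℂ :=
  polyDeriv P Φ z + z⁻¹ * polyDeriv Q Φ z + z⁻¹ ^ 2 * (∑' j : ℕ, R j * z⁻¹ ^ j) * Φ z

/-- The Laplace transform along the ray from `α` at angle `θ`: the integral of `e^{-zζ} φ dζ`. -/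
noncomputable def laplace (α : ℂ) (θ : ℝ) (φ : ℂ → ℂ) (z : ℂ) : ℂ :=
  ∫ r in Set.Ioi (0 : ℝ), Complex.exp (-z * rayPoint α θ r) * φ (rayPoint α θ r)
    * Complex.exp ((θ : ℂ) * Complex.I)

/-- The Laplace transform of `φ` along the ray is well-defined on the half-plane
`Re (z e^{iθ}) > Λ`: the integral that defines it converges absolutely at every point there.
This is so, for example, when `|φ| ≤ C |ζ - α|^σ e^{Λ |ζ - α|}` on the ray with `σ > -1`. -/
def LaplaceWellDefined (α : ℂ) (θ Λ : ℝ) (φ : ℂ → ℂ) : Prop :=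
  ∀ z ∈ halfPlane θ Λ, MeasureTheory.IntegrableOn
    (fun r : ℝ => Complex.exp (-z * rayPoint α θ r) * φ (rayPoint α θ r)
      * Complex.exp ((θ : ℂ) * Complex.I)) (Set.Ioi 0)

end LevelOne

namespace LevelOne

open Set MeasureTheory Filter Topology

/-! Write `s = z e^{iθ}`. Along the ray, the Laplace transform turns multiplication by `-ζ` into
`∂/∂z` (`LaplaceWellDefined.hasDerivAt`). It turns integration from `α` into multiplication by
`z⁻¹`: the weighted integrand is a half-line convolution with `e^{-st}`, whose integral is `s⁻¹` if
`0 < Re s` (`laplace_fracIntegral_one`). The `j`-th iterate is bounded in `L¹` by `(Re s)^{-j}`, so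
the series in `∂⁻¹` can be integrated termwise where `A < Re s`. There `laplace_positionOp` applies,
and the integral equation on the ray makes the transformed expression zero.

The region `A < |z|` of the half-plane is larger. Since `frequencyOp` of the transform is
holomorphic there, the identity theorem extends the vanishing (`eq_zero_of_eq_zero_right`). -/

/-! ### Convolutions and exponential kernels on the half-line. -/

/-- A series of integrable functions with summable `L¹` norms has an integrable sum. -/
theorem integrable_tsum_of_summable_integral_norm {X : Type*} [MeasurableSpace X] {μ : Measure X}
    {F : ℕ → X → ℂ} (hF : ∀ j, Integrable (F j) μ) (hs : Summable fun j => ∫ x, ‖F j x‖ ∂μ) :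
    Integrable (fun x => ∑' j, F j x) μ := by
  have hnorm (j : ℕ) : ∫⁻ x, ‖F j x‖ₑ ∂μ = ENNReal.ofReal (∫ x, ‖F j x‖ ∂μ) :=
    (ofReal_integral_norm_eq_lintegral_enorm (hF j)).symm
  have hsum : ∑' j, ∫⁻ x, ‖F j x‖ₑ ∂μ ≠ ⊤ := by
    simp_rw [hnorm]
    exact hs.tsum_ofReal_ne_top
  have hae : ∀ᵐ x ∂μ, Summable fun j => ‖F j x‖ := by
    refine summable_norm_of_tsum_eLpNorm_ne_top (p := 1) le_rfl (fun j => (hF j).1) ?_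
    simpa only [eLpNorm_one_eq_lintegral_enorm] using hsum
  refine ⟨aestronglyMeasurable_of_tendsto_ae atTop
    (f := fun n x => ∑ j ∈ Finset.range n, F j x)
    (fun n => Finset.aestronglyMeasurable_fun_sum _ fun j _ => (hF j).1) ?_, ?_⟩
  · filter_upwards [hae] with x hx
    exact hx.of_norm.hasSum.tendsto_sum_nat
  · refine lt_of_le_of_lt (lintegral_mono fun x => enorm_tsum_le_tsum_enorm) ?_
    rw [lintegral_tsum fun j => (hF j).1.enorm]
    exact hsum.lt_top

/-- The `L¹` norm of a convolution on the half-line is at most the product of the norms. -/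
theorem integral_norm_posConvolution_le {f g : ℝ → ℂ} (hf : IntegrableOn f (Ioi 0))
    (hg : IntegrableOn g (Ioi 0)) :
    ∫ x in Ioi (0 : ℝ), ‖∫ t in (0 : ℝ)..x, f t * g (x - t)‖
      ≤ (∫ x in Ioi (0 : ℝ), ‖f x‖) * ∫ x in Ioi (0 : ℝ), ‖g x‖ := by
  have hint := integrable_posConvolution (μ := volume) (ν := volume) hf.norm hg.norm
    (ContinuousLinearMap.mul ℝ ℝ)
  have heq := integral_posConvolution (μ := volume) (ν := volume) hf.norm hg.norm
    (ContinuousLinearMap.mul ℝ ℝ)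
  rw [posConvolution, integrable_indicator_iff measurableSet_Ioi] at hint
  simp only [ContinuousLinearMap.mul_apply'] at hint heq
  rw [← heq]
  refine setIntegral_mono_on₀ ?_ hint measurableSet_Ioi.nullMeasurableSet fun x hx => ?_
  · have hconv := integrable_posConvolution (μ := volume) (ν := volume) hf hg
      (ContinuousLinearMap.mul ℝ ℂ)
    rw [posConvolution, integrable_indicator_iff measurableSet_Ioi] at hconv
    exact hconv.norm
  · simpa only [norm_mul] using
      intervalIntegral.norm_integral_le_integral_norm (μ := volume)
        (f := fun t => f t * g (x - t)) (le_of_lt hx)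

theorem integrableOn_conv {f g : ℝ → ℂ} (hf : IntegrableOn f (Ioi 0))
    (hg : IntegrableOn g (Ioi 0)) :
    IntegrableOn (fun x => ∫ t in (0 : ℝ)..x, f t * g (x - t)) (Ioi 0) := by
  have hconv := integrable_posConvolution (μ := volume) (ν := volume) hf hg
    (ContinuousLinearMap.mul ℝ ℂ)
  rw [posConvolution, integrable_indicator_iff measurableSet_Ioi] at hconv
  exact hconv

theorem integral_conv {f g : ℝ → ℂ} (hf : IntegrableOn f (Ioi 0))
    (hg : IntegrableOn g (Ioi 0)) :
    ∫ x in Ioi (0 : ℝ), ∫ t in (0 : ℝ)..x, f t * g (x - t)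
      = (∫ x in Ioi (0 : ℝ), f x) * ∫ x in Ioi (0 : ℝ), g x :=
  integral_posConvolution (μ := volume) (ν := volume) hf hg (ContinuousLinearMap.mul ℝ ℂ)

theorem integrableOn_exp_neg_mul {s : ℂ} (hs : 0 < s.re) :
    IntegrableOn (fun t : ℝ => Complex.exp (-s * t)) (Ioi 0) :=
  integrableOn_exp_mul_complex_Ioi (by simpa using hs) 0

theorem integral_exp_neg_mul {s : ℂ} (hs : 0 < s.re) :
    ∫ t in Ioi (0 : ℝ), Complex.exp (-s * t) = s⁻¹ := by
  rw [integral_exp_mul_complex_Ioi (by simpa using hs)]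
  simp [neg_div_neg_eq]

theorem integral_norm_exp_neg_mul {s : ℂ} (hs : 0 < s.re) :
    ∫ t in Ioi (0 : ℝ), ‖Complex.exp (-s * t)‖ = s.re⁻¹ := by
  have h := integral_exp_mul_Ioi (a := -s.re) (by simpa using hs) 0
  simp only [mul_zero, Real.exp_zero, neg_div_neg_eq, one_div] at h
  simpa [Complex.norm_exp] using h

/-- The kernel `t e^{-st}` is the self-convolution of `e^{-st}`, so its integrability and integral
follow from those of the exponential. -/
theorem integral_exp_mul_exp (s : ℂ) (r : ℝ) :
    ∫ t in (0 : ℝ)..r, Complex.exp (-s * t) * Complex.exp (-s * ((r - t : ℝ) : ℂ))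
      = r * Complex.exp (-s * r) := by
  have h (t : ℝ) : Complex.exp (-s * t) * Complex.exp (-s * ((r - t : ℝ) : ℂ))
      = Complex.exp (-s * r) := by
    rw [← Complex.exp_add]
    congr 1
    push_cast
    ring
  simp_rw [h]
  simp

theorem integrableOn_mul_exp_neg_mul {s : ℂ} (hs : 0 < s.re) :
    IntegrableOn (fun t : ℝ => (t : ℂ) * Complex.exp (-s * t)) (Ioi 0) := by
  simpa only [integral_exp_mul_exp] using
    integrableOn_conv (integrableOn_exp_neg_mul hs) (integrableOn_exp_neg_mul hs)

theorem integral_mul_exp_neg_mul {s : ℂ} (hs : 0 < s.re) :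
    ∫ t in Ioi (0 : ℝ), (t : ℂ) * Complex.exp (-s * t) = s⁻¹ ^ 2 := by
  have h := integral_conv (integrableOn_exp_neg_mul hs) (integrableOn_exp_neg_mul hs)
  simp only [integral_exp_mul_exp] at h
  rw [h, integral_exp_neg_mul hs, sq]

/-! ### Integration from the base point as a convolution. -/

/-- The integrand of the Laplace transform along a ray. -/
noncomputable def laplaceIntegrand (α : ℂ) (θ : ℝ) (φ : ℂ → ℂ) (z : ℂ) (r : ℝ) : ℂ :=
  Complex.exp (-z * rayPoint α θ r) * φ (rayPoint α θ r) * Complex.exp ((θ : ℂ) * Complex.I)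

/-- The Laplace integral along a ray converges absolutely at `z`. -/
def LaplaceIntegrable (α : ℂ) (θ : ℝ) (φ : ℂ → ℂ) (z : ℂ) : Prop :=
  IntegrableOn (laplaceIntegrand α θ φ z) (Ioi 0)

theorem laplace_eq (α : ℂ) (θ : ℝ) (φ : ℂ → ℂ) (z : ℂ) :
    laplace α θ φ z = ∫ r in Ioi (0 : ℝ), laplaceIntegrand α θ φ z r := rfl

variable {α : ℂ} {θ : ℝ} {φ : ℂ → ℂ} {z : ℂ}

theorem norm_direction (θ : ℝ) : ‖Complex.exp ((θ : ℂ) * Complex.I)‖ = 1 :=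
  Complex.norm_exp_ofReal_mul_I θ

theorem segIntegral_rayPoint (α : ℂ) (θ r : ℝ) (f : ℂ → ℂ) :
    segIntegral α (rayPoint α θ r) f
      = Complex.exp ((θ : ℂ) * Complex.I) * ∫ t in (0 : ℝ)..r, f (rayPoint α θ t) := by
  have h := intervalIntegral.smul_integral_comp_mul_left (a := 0) (b := 1)
    (fun t => f (rayPoint α θ t)) r
  rw [mul_zero, mul_one] at h
  rw [← h, segIntegral, intervalIntegral.integral_mul_const, Complex.real_smul]
  have hp (t : ℝ) : α + (t : ℂ) * (rayPoint α θ r - α) = rayPoint α θ (r * t) := by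
    simp only [rayPoint]
    push_cast
    ring
  simp_rw [hp]
  simp only [rayPoint]
  ring

/-- The exponential weight at `r` is the weight at `t` times `e^{-s(r-t)}`, with `s = z e^{iθ}`. -/
theorem laplaceIntegrand_fracIntegral_one (α : ℂ) (θ : ℝ) (φ : ℂ → ℂ) (z : ℂ) (r : ℝ) :
    laplaceIntegrand α θ (fracIntegral α 1 φ) z r
      = Complex.exp ((θ : ℂ) * Complex.I) * ∫ t in (0 : ℝ)..r, laplaceIntegrand α θ φ z t *
        Complex.exp (-(z * Complex.exp ((θ : ℂ) * Complex.I)) * ((r - t : ℝ) : ℂ)) := by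
  have h (t : ℝ) : laplaceIntegrand α θ φ z t *
        Complex.exp (-(z * Complex.exp ((θ : ℂ) * Complex.I)) * ((r - t : ℝ) : ℂ))
      = Complex.exp (-z * rayPoint α θ r) * Complex.exp ((θ : ℂ) * Complex.I)
        * φ (rayPoint α θ t) := by
    have he : Complex.exp (-z * rayPoint α θ r) = Complex.exp (-z * rayPoint α θ t) *
        Complex.exp (-(z * Complex.exp ((θ : ℂ) * Complex.I)) * ((r - t : ℝ) : ℂ)) := by
      rw [← Complex.exp_add]
      congr 1
      simp only [rayPoint]
      push_cast
      ring
    rw [he, laplaceIntegrand]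
    ring
  simp_rw [h]
  rw [intervalIntegral.integral_const_mul, laplaceIntegrand, fracIntegral, segIntegral_rayPoint]
  simp only [Nat.sub_self, Nat.factorial_zero, Nat.cast_one, inv_one, pow_zero, one_mul]
  ring

/-- Of the two direction factors outside the integral, one comes from `dζ` and one from `a - ζ = (r
- t) e^{iθ}`. -/
theorem laplaceIntegrand_fracIntegral_two (α : ℂ) (θ : ℝ) (φ : ℂ → ℂ) (z : ℂ) (r : ℝ) :
    laplaceIntegrand α θ (fracIntegral α 2 φ) z r
      = Complex.exp ((θ : ℂ) * Complex.I) ^ 2 *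
        ∫ t in (0 : ℝ)..r, laplaceIntegrand α θ φ z t * (((r - t : ℝ) : ℂ) *
          Complex.exp (-(z * Complex.exp ((θ : ℂ) * Complex.I)) * ((r - t : ℝ) : ℂ))) := by
  have h (t : ℝ) : laplaceIntegrand α θ φ z t * (((r - t : ℝ) : ℂ) *
        Complex.exp (-(z * Complex.exp ((θ : ℂ) * Complex.I)) * ((r - t : ℝ) : ℂ)))
      = Complex.exp (-z * rayPoint α θ r)
        * ((rayPoint α θ r - rayPoint α θ t) * φ (rayPoint α θ t)) := by
    have he : Complex.exp (-z * rayPoint α θ r) = Complex.exp (-z * rayPoint α θ t) *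
        Complex.exp (-(z * Complex.exp ((θ : ℂ) * Complex.I)) * ((r - t : ℝ) : ℂ)) := by
      rw [← Complex.exp_add]
      congr 1
      simp only [rayPoint]
      push_cast
      ring
    rw [he, laplaceIntegrand]
    have hd : rayPoint α θ r - rayPoint α θ t
        = ((r - t : ℝ) : ℂ) * Complex.exp ((θ : ℂ) * Complex.I) := by
      simp only [rayPoint]
      push_cast
      ring
    rw [hd]
    ring
  simp_rw [h]
  rw [intervalIntegral.integral_const_mul, laplaceIntegrand, fracIntegral, segIntegral_rayPoint]
  simp only [Nat.add_one_sub_one, Nat.factorial_one, Nat.cast_one, inv_one, pow_one, one_mul]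
  ring

theorem LaplaceIntegrable.fracIntegral_one (hφ : LaplaceIntegrable α θ φ z)
    (hz : 0 < (z * Complex.exp ((θ : ℂ) * Complex.I)).re) :
    LaplaceIntegrable α θ (fracIntegral α 1 φ) z := by
  rw [LaplaceIntegrable, funext (laplaceIntegrand_fracIntegral_one α θ φ z)]
  exact (integrableOn_conv hφ (integrableOn_exp_neg_mul hz)).const_mul _

theorem laplace_fracIntegral_one (hφ : LaplaceIntegrable α θ φ z)
    (hz : 0 < (z * Complex.exp ((θ : ℂ) * Complex.I)).re) :
    laplace α θ (fracIntegral α 1 φ) z = z⁻¹ * laplace α θ φ z := by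
  simp_rw [laplace_eq, laplaceIntegrand_fracIntegral_one]
  rw [integral_const_mul, integral_conv hφ (integrableOn_exp_neg_mul hz), integral_exp_neg_mul hz,
    mul_inv]
  field_simp [Complex.exp_ne_zero]

/-- The kernel has `L¹` norm `1 / Re s`, in general larger than the exact factor `1 / |z|` of the
transform. This loss is what restricts the termwise argument to `A < Re s`. -/
theorem integral_norm_fracIntegral_one_le (hφ : LaplaceIntegrable α θ φ z)
    (hz : 0 < (z * Complex.exp ((θ : ℂ) * Complex.I)).re) :
    ∫ r in Ioi (0 : ℝ), ‖laplaceIntegrand α θ (fracIntegral α 1 φ) z r‖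
      ≤ (z * Complex.exp ((θ : ℂ) * Complex.I)).re⁻¹
        * ∫ r in Ioi (0 : ℝ), ‖laplaceIntegrand α θ φ z r‖ := by
  simp_rw [laplaceIntegrand_fracIntegral_one, norm_mul (Complex.exp _) (intervalIntegral _ _ _ _),
    norm_direction, one_mul]
  rw [← integral_norm_exp_neg_mul hz]
  exact (integral_norm_posConvolution_le hφ (integrableOn_exp_neg_mul hz)).trans_eq (mul_comm _ _)

theorem LaplaceIntegrable.fracIntegral_two (hφ : LaplaceIntegrable α θ φ z)
    (hz : 0 < (z * Complex.exp ((θ : ℂ) * Complex.I)).re) :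
    LaplaceIntegrable α θ (fracIntegral α 2 φ) z := by
  rw [LaplaceIntegrable, funext (laplaceIntegrand_fracIntegral_two α θ φ z)]
  exact (integrableOn_conv hφ (integrableOn_mul_exp_neg_mul hz)).const_mul _

theorem laplace_fracIntegral_two (hφ : LaplaceIntegrable α θ φ z)
    (hz : 0 < (z * Complex.exp ((θ : ℂ) * Complex.I)).re) :
    laplace α θ (fracIntegral α 2 φ) z = z⁻¹ ^ 2 * laplace α θ φ z := by
  simp_rw [laplace_eq, laplaceIntegrand_fracIntegral_two]
  rw [integral_const_mul, integral_conv hφ (integrableOn_mul_exp_neg_mul hz),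
    integral_mul_exp_neg_mul hz, mul_inv]
  field_simp [Complex.exp_ne_zero]

/-! ### Iterated integrals and the series `R(∂⁻¹)`. -/

theorem LaplaceIntegrable.iterate (hφ : LaplaceIntegrable α θ φ z)
    (hz : 0 < (z * Complex.exp ((θ : ℂ) * Complex.I)).re) (j : ℕ) :
    LaplaceIntegrable α θ ((fracIntegral α 1)^[j] φ) z := by
  induction j with
  | zero => exact hφ
  | succ j ih =>
    rw [Function.iterate_succ_apply']
    exact ih.fracIntegral_one hz

theorem laplace_iterate (hφ : LaplaceIntegrable α θ φ z)
    (hz : 0 < (z * Complex.exp ((θ : ℂ) * Complex.I)).re) (j : ℕ) :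
    laplace α θ ((fracIntegral α 1)^[j] φ) z = z⁻¹ ^ j * laplace α θ φ z := by
  induction j with
  | zero => simp
  | succ j ih =>
    rw [Function.iterate_succ_apply', laplace_fracIntegral_one (hφ.iterate hz j) hz, ih]
    ring

theorem integral_norm_iterate_le (hφ : LaplaceIntegrable α θ φ z)
    (hz : 0 < (z * Complex.exp ((θ : ℂ) * Complex.I)).re) (j : ℕ) :
    ∫ r in Ioi (0 : ℝ), ‖laplaceIntegrand α θ ((fracIntegral α 1)^[j] φ) z r‖
      ≤ (z * Complex.exp ((θ : ℂ) * Complex.I)).re⁻¹ ^ j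
        * ∫ r in Ioi (0 : ℝ), ‖laplaceIntegrand α θ φ z r‖ := by
  induction j with
  | zero => simp
  | succ j ih =>
    rw [Function.iterate_succ_apply']
    refine (integral_norm_fracIntegral_one_le (hφ.iterate hz j) hz).trans ?_
    refine (mul_le_mul_of_nonneg_left ih (inv_nonneg.2 hz.le)).trans_eq ?_
    ring

theorem laplaceIntegrand_seriesOfIntegral (R : ℕ → ℂ) (r : ℝ) :
    laplaceIntegrand α θ (seriesOfIntegral R α φ) z r
      = ∑' j, R j * laplaceIntegrand α θ ((fracIntegral α 1)^[j] φ) z r := by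
  simp only [laplaceIntegrand, seriesOfIntegral]
  rw [← tsum_mul_left, ← tsum_mul_right]
  congr 1 with j
  ring

theorem summable_integral_norm_seriesOfIntegral (hφ : LaplaceIntegrable α θ φ z)
    (hz : 0 < (z * Complex.exp ((θ : ℂ) * Complex.I)).re) {R : ℕ → ℂ}
    (hR : Summable fun j => ‖R j‖ * (z * Complex.exp ((θ : ℂ) * Complex.I)).re⁻¹ ^ j) :
    Summable fun j => ∫ r in Ioi (0 : ℝ),
      ‖R j * laplaceIntegrand α θ ((fracIntegral α 1)^[j] φ) z r‖ := by
  refine Summable.of_nonneg_of_le (fun j => integral_nonneg fun r => norm_nonneg _) (fun j => ?_)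
    (hR.mul_right (∫ r in Ioi (0 : ℝ), ‖laplaceIntegrand α θ φ z r‖))
  simp_rw [norm_mul (R j)]
  rw [integral_const_mul, mul_assoc]
  exact mul_le_mul_of_nonneg_left (integral_norm_iterate_le hφ hz j) (norm_nonneg _)

theorem LaplaceIntegrable.seriesOfIntegral (hφ : LaplaceIntegrable α θ φ z)
    (hz : 0 < (z * Complex.exp ((θ : ℂ) * Complex.I)).re) {R : ℕ → ℂ}
    (hR : Summable fun j => ‖R j‖ * (z * Complex.exp ((θ : ℂ) * Complex.I)).re⁻¹ ^ j) :
    LaplaceIntegrable α θ (seriesOfIntegral R α φ) z := by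
  rw [LaplaceIntegrable, funext (laplaceIntegrand_seriesOfIntegral R)]
  exact integrable_tsum_of_summable_integral_norm (fun j => (hφ.iterate hz j).const_mul _)
    (summable_integral_norm_seriesOfIntegral hφ hz hR)

theorem laplace_seriesOfIntegral (hφ : LaplaceIntegrable α θ φ z)
    (hz : 0 < (z * Complex.exp ((θ : ℂ) * Complex.I)).re) {R : ℕ → ℂ}
    (hR : Summable fun j => ‖R j‖ * (z * Complex.exp ((θ : ℂ) * Complex.I)).re⁻¹ ^ j) :
    laplace α θ (seriesOfIntegral R α φ) z = (∑' j, R j * z⁻¹ ^ j) * laplace α θ φ z := by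
  rw [laplace_eq, funext (laplaceIntegrand_seriesOfIntegral R),
    ← integral_tsum_of_summable_integral_norm (fun j => (hφ.iterate hz j).const_mul _)
      (summable_integral_norm_seriesOfIntegral hφ hz hR), ← tsum_mul_right]
  congr 1 with j
  rw [integral_const_mul, ← laplace_eq, laplace_iterate hφ hz]
  ring

/-! ### Differentiation in the frequency variable. -/

variable {Λ : ℝ}

theorem isOpen_halfPlane (θ Λ : ℝ) : IsOpen (halfPlane θ Λ) :=
  isOpen_lt continuous_const (by fun_prop)

theorem LaplaceWellDefined.integrable (hφ : LaplaceWellDefined α θ Λ φ) (hz : z ∈ halfPlane θ Λ) :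
    LaplaceIntegrable α θ φ z :=
  hφ z hz

theorem continuous_rayPoint (α : ℂ) (θ : ℝ) : Continuous (rayPoint α θ) := by
  unfold rayPoint
  fun_prop

theorem laplaceIntegrand_neg_mul (r : ℝ) :
    laplaceIntegrand α θ (fun ζ => -ζ * φ ζ) z r
      = -rayPoint α θ r * laplaceIntegrand α θ φ z r := by
  simp only [laplaceIntegrand]
  ring

theorem laplaceIntegrand_change (z w : ℂ) (r : ℝ) :
    laplaceIntegrand α θ φ z r
      = Complex.exp ((w - z) * rayPoint α θ r) * laplaceIntegrand α θ φ w r := by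
  have h : Complex.exp (-z * rayPoint α θ r)
      = Complex.exp ((w - z) * rayPoint α θ r) * Complex.exp (-w * rayPoint α θ r) := by
    rw [← Complex.exp_add]
    congr 1
    ring
  simp only [laplaceIntegrand, h]
  ring

/-- The decay `e^{-εr}` absorbs the linear growth of the factor `ζ` produced by differentiation.
Here `w` is a difference of two frequencies. -/
theorem norm_rayPoint_mul_exp_le {ε : ℝ} (hε : 0 < ε) {w : ℂ} (hw : ‖w‖ ≤ 3 * ε)
    (hre : (w * Complex.exp ((θ : ℂ) * Complex.I)).re ≤ -ε) {r : ℝ} (hr : 0 ≤ r) :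
    ‖rayPoint α θ r‖ * ‖Complex.exp (w * rayPoint α θ r)‖
      ≤ (‖α‖ + ε⁻¹) * Real.exp (3 * ε * ‖α‖) := by
  have h1 : ‖rayPoint α θ r‖ ≤ ‖α‖ + r := by
    refine (norm_add_le _ _).trans_eq ?_
    rw [norm_mul, norm_direction, mul_one, Complex.norm_real, Real.norm_of_nonneg hr]
  have h2 : (w * rayPoint α θ r).re ≤ 3 * ε * ‖α‖ + -(ε * r) := by
    have he : w * rayPoint α θ r
        = w * α + (r : ℂ) * (w * Complex.exp ((θ : ℂ) * Complex.I)) := by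
      rw [rayPoint]
      ring
    rw [he, Complex.add_re, Complex.re_ofReal_mul]
    refine add_le_add ?_ (by nlinarith)
    refine (Complex.re_le_norm _).trans ?_
    rw [norm_mul]
    gcongr
  have h3 : (‖α‖ + r) * Real.exp (-(ε * r)) ≤ ‖α‖ + ε⁻¹ := by
    rw [Real.exp_neg, ← div_eq_mul_inv, div_le_iff₀ (Real.exp_pos _)]
    have h4 := Real.add_one_le_exp (ε * r)
    have h5 : ‖α‖ + r ≤ (‖α‖ + ε⁻¹) * (ε * r + 1) := by
      have h6 : (‖α‖ + ε⁻¹) * (ε * r + 1) = ‖α‖ + r + (‖α‖ * (ε * r) + ε⁻¹) := by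
        field_simp
        ring
      rw [h6]
      have : 0 ≤ ‖α‖ * (ε * r) + ε⁻¹ := by positivity
      linarith
    exact h5.trans (by gcongr)
  rw [Complex.norm_exp]
  calc ‖rayPoint α θ r‖ * Real.exp (w * rayPoint α θ r).re
      ≤ (‖α‖ + r) * Real.exp (3 * ε * ‖α‖ + -(ε * r)) := by gcongr
    _ = (‖α‖ + r) * Real.exp (-(ε * r)) * Real.exp (3 * ε * ‖α‖) := by
      rw [Real.exp_add]
      ring
    _ ≤ _ := by gcongr

/-- Differentiation under the integral, dominated by the integrand at a frequency nearer the
boundary; absolute convergence on the open half-plane is thus enough. The same argument gives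
integrability of the derivative. -/
theorem LaplaceWellDefined.hasDerivAt_aux (hφ : LaplaceWellDefined α θ Λ φ)
    (hz : z ∈ halfPlane θ Λ) :
    LaplaceIntegrable α θ (fun ζ => -ζ * φ ζ) z ∧
      HasDerivAt (laplace α θ φ) (laplace α θ (fun ζ => -ζ * φ ζ) z) z := by
  have hz' : Λ < (z * Complex.exp ((θ : ℂ) * Complex.I)).re := hz
  obtain ⟨ε, hε, hεz⟩ : ∃ ε : ℝ, 0 < ε ∧ Λ < (z * Complex.exp ((θ : ℂ) * Complex.I)).re - 2 * ε :=
    ⟨((z * Complex.exp ((θ : ℂ) * Complex.I)).re - Λ) / 4, by linarith, by linarith⟩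
  set u := Complex.exp ((θ : ℂ) * Complex.I) with hu
  have hu0 : u ≠ 0 := Complex.exp_ne_zero _
  have hun : ‖u‖ = 1 := norm_direction θ
  -- This is `z` moved halfway to the boundary. For `y` within `ε` of `z`, it gives `‖w - y‖ ≤ 3ε`
  -- and `Re ((w - y)u) ≤ -ε`.
  set w : ℂ := z - 2 * ε * u⁻¹ with hw
  have hwu : w * u = z * u - ((2 * ε : ℝ) : ℂ) := by
    rw [hw]
    push_cast
    field_simp
  have hwmem : w ∈ halfPlane θ Λ := by
    change Λ < (w * u).re
    rw [hwu, Complex.sub_re, Complex.ofReal_re]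
    exact hεz
  have hwz : ‖w - z‖ = 2 * ε := by
    rw [hw, sub_sub_cancel_left, norm_neg, norm_mul, norm_mul, norm_inv, hun, Complex.norm_real,
      Real.norm_of_nonneg hε.le]
    norm_num
  refine hasDerivAt_integral_of_dominated_loc_of_deriv_le
    (F := fun y r => laplaceIntegrand α θ φ y r)
    (F' := fun y r => laplaceIntegrand α θ (fun ζ => -ζ * φ ζ) y r)
    (bound := fun r => (‖α‖ + ε⁻¹) * Real.exp (3 * ε * ‖α‖) * ‖laplaceIntegrand α θ φ w r‖)
    (Metric.ball_mem_nhds z hε) ?_ (hφ.integrable hz) ?_ ?_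
    ((hφ.integrable hwmem).norm.const_mul _) ?_
  · filter_upwards [(isOpen_halfPlane θ Λ).mem_nhds hz] with y hy
    exact (hφ.integrable hy).aestronglyMeasurable
  · simp_rw [laplaceIntegrand_neg_mul]
    exact (continuous_rayPoint α θ).neg.aestronglyMeasurable.mul
      (hφ.integrable hz).aestronglyMeasurable
  · refine (ae_restrict_iff' measurableSet_Ioi).2 (ae_of_all _ fun r hr y hy => ?_)
    have hyz : ‖z - y‖ ≤ ε := by
      rw [norm_sub_rev, ← dist_eq_norm]
      exact (Metric.mem_ball.1 hy).le
    rw [laplaceIntegrand_neg_mul, laplaceIntegrand_change y w, norm_mul, norm_mul, norm_neg,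
      ← mul_assoc]
    refine mul_le_mul_of_nonneg_right (norm_rayPoint_mul_exp_le hε ?_ ?_ (le_of_lt hr))
      (norm_nonneg _)
    · have := norm_add_le (w - z) (z - y)
      rw [sub_add_sub_cancel, hwz] at this
      linarith
    · have h1 : (w - y) * u = (z - y) * u - ((2 * ε : ℝ) : ℂ) := by
        rw [sub_mul, hwu]
        ring
      have h2 : ((z - y) * u).re ≤ ε := by
        refine (Complex.re_le_norm _).trans ?_
        rwa [norm_mul, hun, mul_one]
      rw [← hu, h1, Complex.sub_re, Complex.ofReal_re]
      linarith
  · refine ae_of_all _ fun r y _ => ?_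
    have h := (((hasDerivAt_id y).neg.mul_const (rayPoint α θ r)).cexp.mul_const
      (φ (rayPoint α θ r))).mul_const (Complex.exp ((θ : ℂ) * Complex.I))
    refine h.congr_deriv ?_
    simp only [laplaceIntegrand, Pi.neg_apply, id]
    ring

theorem LaplaceWellDefined.neg_mul (hφ : LaplaceWellDefined α θ Λ φ) :
    LaplaceWellDefined α θ Λ (fun ζ => -ζ * φ ζ) :=
  fun _ hz => (hφ.hasDerivAt_aux hz).1

theorem LaplaceWellDefined.hasDerivAt (hφ : LaplaceWellDefined α θ Λ φ)
    (hz : z ∈ halfPlane θ Λ) :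
    HasDerivAt (laplace α θ φ) (laplace α θ (fun ζ => -ζ * φ ζ) z) z :=
  (hφ.hasDerivAt_aux hz).2

theorem LaplaceWellDefined.differentiableOn (hφ : LaplaceWellDefined α θ Λ φ) :
    DifferentiableOn ℂ (laplace α θ φ) (halfPlane θ Λ) :=
  fun _ hz => (hφ.hasDerivAt hz).differentiableAt.differentiableWithinAt

theorem LaplaceWellDefined.neg_pow_mul (hφ : LaplaceWellDefined α θ Λ φ) (n : ℕ) :
    LaplaceWellDefined α θ Λ (fun ζ => (-ζ) ^ n * φ ζ) := by
  induction n with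
  | zero => simpa using hφ
  | succ n ih =>
    convert! ih.neg_mul using 2 with ζ
    ring

theorem LaplaceWellDefined.iteratedDeriv_laplace (hφ : LaplaceWellDefined α θ Λ φ) (n : ℕ)
    (hz : z ∈ halfPlane θ Λ) :
    iteratedDeriv n (laplace α θ φ) z = laplace α θ (fun ζ => (-ζ) ^ n * φ ζ) z := by
  induction n generalizing z with
  | zero => simp
  | succ n ih =>
    have he : iteratedDeriv n (laplace α θ φ) =ᶠ[𝓝 z]
        laplace α θ (fun ζ => (-ζ) ^ n * φ ζ) := by
      filter_upwards [(isOpen_halfPlane θ Λ).mem_nhds hz] with y hy using ih hy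
    rw [iteratedDeriv_succ, he.deriv_eq, ((hφ.neg_pow_mul n).hasDerivAt hz).deriv]
    congr 1 with ζ
    ring

theorem laplaceIntegrand_eval_mul (P : Polynomial ℂ) (r : ℝ) :
    laplaceIntegrand α θ (fun ζ => P.eval (-ζ) * φ ζ) z r
      = ∑ n ∈ P.support, P.coeff n * laplaceIntegrand α θ (fun ζ => (-ζ) ^ n * φ ζ) z r := by
  simp only [laplaceIntegrand, Polynomial.eval_eq_sum, Polynomial.sum, Finset.sum_mul,
    Finset.mul_sum]
  refine Finset.sum_congr rfl fun n _ => ?_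
  ring

theorem LaplaceWellDefined.eval_mul (hφ : LaplaceWellDefined α θ Λ φ) (P : Polynomial ℂ) :
    LaplaceWellDefined α θ Λ (fun ζ => P.eval (-ζ) * φ ζ) := by
  intro z hz
  change IntegrableOn (laplaceIntegrand α θ (fun ζ => P.eval (-ζ) * φ ζ) z) (Ioi 0)
  rw [funext (laplaceIntegrand_eval_mul P)]
  exact integrable_finsetSum _ fun n _ => ((hφ.neg_pow_mul n).integrable hz).const_mul _

theorem LaplaceWellDefined.laplace_eval_mul (hφ : LaplaceWellDefined α θ Λ φ) (P : Polynomial ℂ)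
    (hz : z ∈ halfPlane θ Λ) :
    laplace α θ (fun ζ => P.eval (-ζ) * φ ζ) z = polyDeriv P (laplace α θ φ) z := by
  rw [laplace_eq, funext (laplaceIntegrand_eval_mul P),
    integral_finsetSum _ fun n _ => ((hφ.neg_pow_mul n).integrable hz).const_mul _]
  refine Finset.sum_congr rfl fun n _ => ?_
  simp only [integral_const_mul, ← laplace_eq, hφ.iteratedDeriv_laplace n hz]

/-- On the half-plane this is again a well-defined Laplace transform, hence holomorphic. -/
theorem LaplaceWellDefined.differentiableOn_polyDeriv (hφ : LaplaceWellDefined α θ Λ φ)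
    (P : Polynomial ℂ) : DifferentiableOn ℂ (polyDeriv P (laplace α θ φ)) (halfPlane θ Λ) :=
  (hφ.eval_mul P).differentiableOn.congr fun _ hz => (hφ.laplace_eval_mul P hz).symm

/-! ### Holomorphy of the transformed expression. -/

theorem summable_norm_mul_inv_pow {R : ℕ → ℂ} {A x : ℝ}
    (hR : ∀ z : ℂ, A < ‖z‖ → Summable fun j : ℕ => R j * z⁻¹ ^ j) (hx : 0 < x) (hAx : A < x) :
    Summable fun j => ‖R j‖ * x⁻¹ ^ j := by
  have h := (hR x (by rwa [Complex.norm_real, Real.norm_of_nonneg hx.le])).norm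
  simpa [Real.norm_of_nonneg hx.le, abs_of_pos hx] using h

theorem differentiableAt_tsum_mul_inv_pow {R : ℕ → ℂ} {A : ℝ} (hA : 0 ≤ A)
    (hR : ∀ z : ℂ, A < ‖z‖ → Summable fun j : ℕ => R j * z⁻¹ ^ j) (hz : A < ‖z‖) :
    DifferentiableAt ℂ (fun y : ℂ => ∑' j : ℕ, R j * y⁻¹ ^ j) z := by
  -- The terms on `B < ‖y‖` are dominated by the convergent series of norms at radius `B`.
  obtain ⟨B, hAB, hBz⟩ := exists_between hz
  have hB : 0 < B := hA.trans_lt hAB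
  have hopen : IsOpen {y : ℂ | B < ‖y‖} := isOpen_lt continuous_const continuous_norm
  refine (Complex.differentiableOn_tsum_of_summable_norm (summable_norm_mul_inv_pow hR hB hAB)
    (fun j y hy => ?_) hopen fun j y hy => ?_).differentiableAt (hopen.mem_nhds hBz)
  · have hy0 : y ≠ 0 := norm_pos_iff.1 (hB.trans hy)
    exact (((differentiableAt_inv hy0).pow j).const_mul _).differentiableWithinAt
  · rw [norm_mul, norm_pow, norm_inv]
    have : ‖y‖⁻¹ ≤ B⁻¹ := inv_anti₀ hB (le_of_lt hy)
    gcongr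

theorem LaplaceWellDefined.differentiableAt_frequencyOp (hφ : LaplaceWellDefined α θ Λ φ)
    (P Q : Polynomial ℂ) {R : ℕ → ℂ} {A : ℝ} (hA : 0 ≤ A)
    (hR : ∀ z : ℂ, A < ‖z‖ → Summable fun j : ℕ => R j * z⁻¹ ^ j)
    (hz : z ∈ halfPlane θ Λ) (hAz : A < ‖z‖) :
    DifferentiableAt ℂ (frequencyOp P Q R (laplace α θ φ)) z := by
  have hnhds := (isOpen_halfPlane θ Λ).mem_nhds hz
  have hinv : DifferentiableAt ℂ (fun y : ℂ => y⁻¹) z :=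
    differentiableAt_inv (norm_pos_iff.1 (hA.trans_lt hAz))
  exact (((hφ.differentiableOn_polyDeriv P).differentiableAt hnhds).add
    (hinv.mul ((hφ.differentiableOn_polyDeriv Q).differentiableAt hnhds))).add
    (((hinv.pow 2).mul (differentiableAt_tsum_mul_inv_pow hA hR hAz)).mul
      (hφ.differentiableOn.differentiableAt hnhds))

/-! ### The transformed equation far to the right. -/

/-- Far enough to the right, the Laplace transform turns the position operator into the frequency
operator. -/
theorem laplace_positionOp (hφ : LaplaceWellDefined α θ Λ φ)
    (P Q : Polynomial ℂ) {R : ℕ → ℂ} {A : ℝ} (hA : 0 ≤ A)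
    (hR : ∀ z : ℂ, A < ‖z‖ → Summable fun j : ℕ => R j * z⁻¹ ^ j)
    (hz : z ∈ halfPlane θ Λ) (hAz : A < (z * Complex.exp ((θ : ℂ) * Complex.I)).re) :
    laplace α θ (positionOp P Q R α φ) z = frequencyOp P Q R (laplace α θ φ) z := by
  have h0 := hA.trans_lt hAz
  have hRs := summable_norm_mul_inv_pow hR h0 hAz
  have hP := (hφ.eval_mul P).integrable hz
  have hQ := (hφ.eval_mul Q).integrable hz
  have hS := (hφ.integrable hz).seriesOfIntegral h0 hRs
  have hsplit (r : ℝ) : laplaceIntegrand α θ (positionOp P Q R α φ) z r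
      = laplaceIntegrand α θ (fun ζ => P.eval (-ζ) * φ ζ) z r
        + laplaceIntegrand α θ (fracIntegral α 1 (fun ζ => Q.eval (-ζ) * φ ζ)) z r
        + laplaceIntegrand α θ (fracIntegral α 2 (seriesOfIntegral R α φ)) z r := by
    simp only [laplaceIntegrand, positionOp]
    ring
  have hadd := (integral_add (hP.add (hQ.fracIntegral_one h0)) (hS.fracIntegral_two h0)).trans
    (congrArg (· + _) (integral_add hP (hQ.fracIntegral_one h0)))
  rw [laplace_eq, funext hsplit]
  refine hadd.trans ?_
  rw [← laplace_eq, ← laplace_eq,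
    ← laplace_eq, laplace_fracIntegral_one hQ h0, laplace_fracIntegral_two hS h0,
    hφ.laplace_eval_mul P hz, hφ.laplace_eval_mul Q hz,
    laplace_seriesOfIntegral (hφ.integrable hz) h0 hRs, frequencyOp]
  ring

theorem rayPoint_mem_ray {r : ℝ} (hr : 0 < r) : rayPoint α θ r ∈ ray α θ :=
  ⟨r, hr, rfl⟩

theorem openSegment_rayPoint_subset {r : ℝ} (hr : 0 < r) :
    openSegment ℝ α (rayPoint α θ r) ⊆ ray α θ := by
  rintro _ ⟨a, b, -, hb, hab, rfl⟩
  refine ⟨b * r, mul_pos hb hr, ?_⟩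
  have ha : (a : ℂ) = 1 - b := by
    rw [← Complex.ofReal_one, ← hab]
    push_cast
    ring
  simp only [rayPoint, Complex.real_smul, ha]
  push_cast
  ring

theorem laplace_eq_zero (h : ∀ r : ℝ, 0 < r → φ (rayPoint α θ r) = 0) : laplace α θ φ z = 0 := by
  refine setIntegral_eq_zero_of_forall_eq_zero fun r hr => ?_
  rw [h r hr]
  ring

/-! ### Analytic continuation around the disk. -/

/-- A point outside the disk of radius `A` lies in a half-plane that avoids this disk and whose
direction is not opposite to a given one. -/
theorem exists_direction {A : ℝ} (hA : 0 ≤ A) (u : ℂ) (hz : A < ‖z‖) :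
    ∃ v : ℂ, ‖v‖ = 1 ∧ u + v ≠ 0 ∧ A < (z * v).re := by
  have hz0 : 0 < ‖z‖ := hA.trans_lt hz
  have hz0' : (‖z‖ : ℂ) ≠ 0 := by exact_mod_cast hz0.ne'
  set v : ℂ := (starRingEnd ℂ) z / ‖z‖ with hv
  have hvn : ‖v‖ = 1 := by
    rw [hv, norm_div, Complex.norm_conj, Complex.norm_real, norm_norm, div_self hz0.ne']
  have hzv : z * v = ‖z‖ := by
    rw [hv, ← mul_div_assoc, Complex.mul_conj', sq, mul_div_assoc, div_self hz0', mul_one]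
  by_cases h : u + v = 0
  · obtain ⟨c, hc, hc1⟩ := exists_between ((div_lt_one hz0).2 hz)
    rw [div_lt_iff₀ hz0] at hc
    have hc0 : 0 ≤ c := by
      by_contra! hneg
      nlinarith
    have hwn : ‖(⟨c, √(1 - c ^ 2)⟩ : ℂ)‖ = 1 := by
      rw [Complex.norm_eq_sqrt_sq_add_sq, Real.sq_sqrt (by nlinarith)]
      simp
    refine ⟨v * ⟨c, √(1 - c ^ 2)⟩, by rw [norm_mul, hvn, hwn, mul_one], fun h1 => ?_, ?_⟩
    · have hv0 : v ≠ 0 := norm_pos_iff.1 (hvn ▸ one_pos)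
      have h2 : (⟨c, √(1 - c ^ 2)⟩ : ℂ) = 1 :=
        mul_left_cancel₀ hv0 (by linear_combination h1 - h)
      exact hc1.ne (congrArg Complex.re h2)
    · rw [← mul_assoc, hzv, Complex.re_ofReal_mul]
      simpa only [mul_comm] using hc
  · exact ⟨v, hvn, h, by rwa [hzv, Complex.ofReal_re]⟩

/-- Two open half-planes whose directions are not opposite have a common point. -/
theorem exists_lt_re {u v : ℂ} (hu : ‖u‖ = 1) (hv : ‖v‖ = 1) (huv : u + v ≠ 0) (M : ℝ) :
    ∃ z : ℂ, M < (z * u).re ∧ M < (z * v).re := by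
  have hu2 : Complex.normSq u = 1 := by rw [Complex.normSq_eq_norm_sq, hu, one_pow]
  have hv2 : Complex.normSq v = 1 := by rw [Complex.normSq_eq_norm_sq, hv, one_pow]
  have hpos : 0 < Complex.normSq (u + v) := Complex.normSq_pos.2 huv
  rw [Complex.normSq_apply] at hu2 hv2 hpos
  simp only [Complex.add_re, Complex.add_im] at hpos
  -- For unit vectors, `|u + v|²` is twice this number.
  have hk : 0 < 1 + (u.re * v.re + u.im * v.im) := by nlinarith
  set k : ℝ := 1 + (u.re * v.re + u.im * v.im) with hkdef
  refine ⟨((|M| + 1) / k : ℝ) * (starRingEnd ℂ) (u + v), ?_⟩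
  have hM : M < (|M| + 1) / k * k := by
    rw [div_mul_cancel₀ _ hk.ne']
    exact (le_abs_self M).trans_lt (lt_add_one _)
  have h1 : ((starRingEnd ℂ) (u + v) * u).re = k := by
    simp only [map_add, Complex.mul_re, Complex.add_re, Complex.add_im, Complex.conj_re,
      Complex.conj_im, hkdef]
    linear_combination hu2
  have h2 : ((starRingEnd ℂ) (u + v) * v).re = k := by
    simp only [map_add, Complex.mul_re, Complex.add_re, Complex.add_im, Complex.conj_re,
      Complex.conj_im, hkdef]
    linear_combination hv2
  rw [mul_assoc, mul_assoc, Complex.re_ofReal_mul, Complex.re_ofReal_mul, h1, h2]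
  exact ⟨hM, hM⟩

/-- A function that is holomorphic on a half-plane outside a disk around `0`, and that vanishes far
enough inside the half-plane, vanishes identically. -/
theorem eq_zero_of_eq_zero_right {A : ℝ} (hA : 0 ≤ A) {F : ℂ → ℂ}
    (hF : ∀ z ∈ halfPlane θ Λ, A < ‖z‖ → DifferentiableAt ℂ F z)
    (hF0 : ∀ z ∈ halfPlane θ Λ, A < (z * Complex.exp ((θ : ℂ) * Complex.I)).re → F z = 0)
    (hz : z ∈ halfPlane θ Λ) (hAz : A < ‖z‖) : F z = 0 := by
  obtain ⟨v, hv, huv, hzv⟩ := exists_direction hA (Complex.exp ((θ : ℂ) * Complex.I)) hAz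
  obtain ⟨w, hwu, hwv⟩ := exists_lt_re (norm_direction θ) hv huv (max A Λ)
  have hhalf (u : ℂ) (c : ℝ) :
      IsOpen {y : ℂ | c < (y * u).re} ∧ Convex ℝ {y : ℂ | c < (y * u).re} :=
    ⟨isOpen_lt continuous_const (by fun_prop),
      convex_halfSpace_gt (f := fun y : ℂ => (y * u).re)
        ⟨fun x y => by simp [add_mul], fun a x => by simp [mul_assoc]⟩ c⟩
  -- An intersection of half-planes is convex, so no connectedness of the half-plane minus the disk
  -- is needed. `U` avoids the disk, contains `z`, and meets the region of known vanishing at `w`.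
  set U : Set ℂ := halfPlane θ Λ ∩ {y | A < (y * v).re} with hU
  have hUo : IsOpen U := (hhalf _ Λ).1.inter (hhalf v A).1
  have hUc : IsPreconnected U := ((hhalf _ Λ).2.inter (hhalf v A).2).isPreconnected
  have hUA (y : ℂ) (hy : y ∈ U) : A < ‖y‖ := by
    have h1 : A < (y * v).re := hy.2
    refine h1.trans_le ((Complex.re_le_norm _).trans_eq ?_)
    rw [norm_mul, hv, mul_one]
  have han : AnalyticOnNhd ℂ F U := DifferentiableOn.analyticOnNhd
    (fun y hy => (hF y hy.1 (hUA y hy)).differentiableWithinAt) hUo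
  have hwU : w ∈ U := ⟨(le_max_right A Λ).trans_lt hwu, (le_max_left A Λ).trans_lt hwv⟩
  refine han.eqOn_zero_of_preconnected_of_eventuallyEq_zero hUc hwU ?_ ⟨hz, hzv⟩
  filter_upwards [hUo.mem_nhds hwU,
    (hhalf _ A).1.mem_nhds ((le_max_left A Λ).trans_lt hwu)] with y hy hy'
  exact hF0 y hy.1 hy'

end LevelOne

theorem lemma4p2
    (P Q : Polynomial ℂ)
    -- the power series `R(z⁻¹) = ∑ R j z⁻ʲ`, which converges for `|z| > A`
    (R : ℕ → ℂ) (A : ℝ) (hA : 0 ≤ A)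
    (hR : ∀ z : ℂ, A < ‖z‖ → Summable fun j : ℕ => R j * z⁻¹ ^ j)
    (α : ℂ) (θ Λ : ℝ)
    -- the position domain, which contains the ray
    (Ω : Set ℂ) (hΩ : IsOpen Ω) (hray : LevelOne.ray α θ ⊆ Ω)
    (ψ : ℂ → ℂ) (hψ : DifferentiableOn ℂ ψ Ω)
    -- the Laplace transform of `ψ` is well-defined on the half-plane
    (hL : LevelOne.LaplaceWellDefined α θ Λ ψ)
    -- the integral equation, at all points of `Ω` that a straight path in `Ω` joins to `α`
    -- (which are all points of `Ω`, if `Ω` is star-shaped around `α`)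
    (heq : ∀ a ∈ Ω, openSegment ℝ α a ⊆ Ω → LevelOne.positionOp P Q R α ψ a = 0) :
    DifferentiableOn ℂ (LevelOne.laplace α θ ψ) (LevelOne.halfPlane θ Λ) ∧
      ∀ z ∈ LevelOne.halfPlane θ Λ, A < ‖z‖ →
        LevelOne.frequencyOp P Q R (LevelOne.laplace α θ ψ) z = 0 := by
  refine ⟨hL.differentiableOn, fun z hz hAz => ?_⟩
  refine LevelOne.eq_zero_of_eq_zero_right hA
    (fun y hy hAy => hL.differentiableAt_frequencyOp P Q hA hR hy hAy) (fun y hy hAy => ?_) hz hAz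
  rw [← LevelOne.laplace_positionOp hL P Q hA hR hy hAy]
  exact LevelOne.laplace_eq_zero fun r hr => heq _ (hray (LevelOne.rayPoint_mem_ray hr))
    ((LevelOne.openSegment_rayPoint_subset hr).trans hray)
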